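/- **Definitions.** Let $V$ be a finite set. A signed digraph $G$ with vertex set $V$ is given by a set of arcs $E\subseteq V\times V\times\{-1,1\}$, where $(j,i,s)\in E$ is an arc from $j$ to $i$ of sign $s$ (a positive and a negative arc from $j$ to $i$ may both be present, and loops are allowed). A cycle of $G$ is a subgraph consisting of $\ell\ge 1$ distinct vertices $v_1,\dots,v_\ell$ and, for each $k$, exactly one arc from $v_k$ to $v_{k+1}$ (indices modulo $\ell$). Its sign is the product of the signs of its arcs. Two cycles intersect if they share a vertex. $G$ is strong if there is a directed path from every vertex to every vertex. A Boolean network (BN) is a map $f:\{0,1\}^V\to\{0,1\}^V$. For $x\in\{0,1\}^V$ and $i\in V$, let $x+e_i$ be obtained from $x$ by flipping the component $i$. The signed interaction graph of $f$ has vertex set $V$ and a positive (resp. negative) arc from $j$ to $i$ if there is $x$ with $x_j=0$ such that $f_i(x+e_j)-f_i(x)$ is positive (resp. negative). A BN on $G$ is a BN whose signed interaction graph is $G$. The asynchronous graph $\Gamma(f)$ is the digraph on $\{0,1\}^V$ with an arc from $x$ to $x+e_i$ whenever $f_i(x)\ne x_i$. A trap set is a set $X\subseteq\{0,1\}^V$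 such that no arc of $\Gamma(f)$ goes from $X$ to its complement; an attractor is an inclusion-minimal non-empty trap set; a trap space is a trap set that is also a subspace, i.e. of the form $[x,y]=\{z: x\le z\le y\}$ with $x\le y$ componentwise. For non-empty $X$, $\langle X\rangle$ denotes the smallest trap space containing $X$. $\Gamma(f)$ is fixing if all its attractors have size one, converging if it has a unique attractor, and trap-separating if $\langle A\rangle\cap\langle B\rangle=\emptyset$ for all distinct attractors $A,B$. $G$ is converging (resp. trap-separating) if $\Gamma(f)$ is converging (resp. trap-separating) for every BN $f$ on $G$. **Proposition.** Let $G$ be a signed digraph with vertex set $V$. Suppose that $G$ has a unique positive cycle $C$, and that every negative cycle of $G$ intersects $C$. Then $G$ is trap-separating; moreover, for every BN $f$ on $G$, $\Gamma(f)$ is fixing or converging. If, in addition, $G$ is strong and has at least one negative cycle, then $G$ is converging. -/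

import Mathlib

namespace BoolNet

/-! ### Signed digraphs, subgraphs and cycles -/

/-- A signed digraph with vertex set `V`: a set of arcs `E ⊆ V² × {-1, 1}`.
The triple `(j, i, s)` is an arc from `j` to `i` of sign `s`. -/
structure SignedDigraph (V : Type*) where
  arcs : Set (V × V × ℤˣ)

namespace SignedDigraph

variable {V : Type*}

/-- A (finite) subgraph `(V', E')` of `G`. -/
@[ext]
structure Subgraph (G : SignedDigraph V) where
  verts : Finset V
  arcs : Finset (V × V × ℤˣ)
  arcs_mem : ∀ a ∈ arcs, a ∈ G.arcs
  source_mem : ∀ a ∈ arcs, a.1 ∈ verts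
  target_mem : ∀ a ∈ arcs, a.2.1 ∈ verts

/-- `C` is a cycle: for some length `m + 1 ≥ 1` there are pairwise distinct vertices
`v 0, …, v m` such that these are the vertices of `C`, and the arcs of `C` are exactly one arc from
`v k` to `v (k + 1)` for each `k`, of sign `s k`. The addition in `Fin (m + 1)` is cyclic, so the
last arc goes from `v m` to `v 0`; for `m = 0` the cycle is a loop. -/
def Subgraph.IsCycle {G : SignedDigraph V} (C : G.Subgraph) : Prop :=
  ∃ (m : ℕ) (v : Fin (m + 1) → V) (s : Fin (m + 1) → ℤˣ),
    Function.Injective v ∧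
    (∀ i, i ∈ C.verts ↔ ∃ k, v k = i) ∧
    (∀ a, a ∈ C.arcs ↔ ∃ k, (v k, v (k + 1), s k) = a)

/-- The product of the signs of the arcs. -/
def Subgraph.sign {G : SignedDigraph V} (C : G.Subgraph) : ℤˣ :=
  ∏ a ∈ C.arcs, a.2.2

def Subgraph.IsPositiveCycle {G : SignedDigraph V} (C : G.Subgraph) : Prop :=
  C.IsCycle ∧ C.sign = 1

def Subgraph.IsNegativeCycle {G : SignedDigraph V} (C : G.Subgraph) : Prop :=
  C.IsCycle ∧ C.sign = -1

/-- Two subgraphs intersect if they share a vertex. -/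
def Subgraph.Intersects {G : SignedDigraph V} (C D : G.Subgraph) : Prop :=
  ∃ i, i ∈ C.verts ∧ i ∈ D.verts

/-- The underlying (unsigned) digraph. -/
def underlying (G : SignedDigraph V) : Digraph V where
  Adj j i := ∃ s, (j, i, s) ∈ G.arcs

/-- `G` is strongly connected: there is a directed path from every vertex to every vertex. -/
def IsStrong (G : SignedDigraph V) : Prop :=
  ∀ j i : V, Relation.ReflTransGen G.underlying.Adj j i

end SignedDigraph

/-! ### Configurations and subspaces -/

/-- Configurations on `V`, with the componentwise order. -/
abbrev Config (V : Type*) := V → Bool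

/-- The configuration `x + e_i`, obtained from `x` by flipping the component `i`. -/
def flipAt {V : Type*} [DecidableEq V] (x : Config V) (i : V) : Config V :=
  Function.update x i (!x i)

/-- A subspace is an interval `[x, y]` with `x ≤ y`. -/
def IsSubspace {V : Type*} (X : Set (Config V)) : Prop :=
  ∃ x y : Config V, x ≤ y ∧ X = Set.Icc x y

/-! ### Dynamics -/

section Dynamics

variable {V : Type*}

/-- `X` is a trap set of `Γ`: no arc of `Γ` leaves `X`. -/
def IsTrapSet (Γ : Digraph (Config V)) (X : Set (Config V)) : Prop :=
  ∀ x ∈ X, ∀ y, Γ.Adj x y → y ∈ X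

/-- A trap space is a subspace which is also a trap set. -/
def IsTrapSpace (Γ : Digraph (Config V)) (X : Set (Config V)) : Prop :=
  IsSubspace X ∧ IsTrapSet Γ X

/-- The smallest trap space `⟨X⟩` containing (the non-empty set) `X`; see `trapHull_isLeast`. -/
def trapHull (Γ : Digraph (Config V)) (X : Set (Config V)) : Set (Config V) :=
  ⋂₀ {Y | IsTrapSpace Γ Y ∧ X ⊆ Y}

theorem trapHull_isLeast (Γ : Digraph (Config V)) {X : Set (Config V)} (hX : X.Nonempty) :
    IsLeast {Y | IsTrapSpace Γ Y ∧ X ⊆ Y} (trapHull Γ X) := by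
  obtain ⟨z, hz⟩ := hX
  refine ⟨⟨⟨?_, ?_⟩, ?_⟩, fun Y hY => Set.sInter_subset_of_mem hY⟩
  · refine ⟨sSup {a | ∃ b, IsTrapSpace Γ (Set.Icc a b) ∧ X ⊆ Set.Icc a b},
      sInf {b | ∃ a, IsTrapSpace Γ (Set.Icc a b) ∧ X ⊆ Set.Icc a b}, ?_, ?_⟩
    · refine le_trans (b := z) (sSup_le ?_) (le_sInf ?_)
      · rintro a ⟨b, -, h⟩
        exact (h hz).1
      · rintro b ⟨a, -, h⟩
        exact (h hz).2
    · ext w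
      simp only [trapHull, Set.mem_sInter, Set.mem_Icc, sSup_le_iff, le_sInf_iff]
      constructor
      · intro h
        refine ⟨?_, ?_⟩
        · rintro a ⟨b, hb⟩
          exact (h _ hb).1
        · rintro b ⟨a, ha⟩
          exact (h _ ha).2
      · rintro ⟨h1, h2⟩ Y ⟨⟨⟨a, b, hab, rfl⟩, hT⟩, hY⟩
        have hI : IsTrapSpace Γ (Set.Icc a b) := ⟨⟨a, b, hab, rfl⟩, hT⟩
        exact ⟨h1 a ⟨b, hI, hY⟩, h2 b ⟨a, hI, hY⟩⟩
  · intro x hx y hxy Y hY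
    exact hY.1.2 x (hx Y hY) y hxy
  · intro x hx Y hY
    exact hY.2 hx

/-- An attractor is an inclusion-minimal non-empty trap set. -/
def IsAttractor (Γ : Digraph (Config V)) (A : Set (Config V)) : Prop :=
  Minimal (fun X : Set (Config V) => X.Nonempty ∧ IsTrapSet Γ X) A

/-- All the attractors are of size one. -/
def IsFixing (Γ : Digraph (Config V)) : Prop :=
  ∀ A, IsAttractor Γ A → A.ncard = 1

/-- There is a unique attractor. -/
def IsConverging (Γ : Digraph (Config V)) : Prop :=
  ∃! A, IsAttractor Γ A

/-- Distinct attractors are contained in disjoint trap spaces: `⟨A⟩ ∩ ⟨B⟩ = ∅`. -/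
def IsTrapSeparating (Γ : Digraph (Config V)) : Prop :=
  ∀ A B, IsAttractor Γ A → IsAttractor Γ B → A ≠ B → trapHull Γ A ∩ trapHull Γ B = ∅

end Dynamics

/-! ### Boolean networks -/

section Networks

variable {V : Type*} [DecidableEq V]

/-- The signed interaction graph `G(f)`: there is a positive (negative) arc from `j` to `i` if for
some configuration `x` with `x_j = 0`, the difference `f_i(x + e_j) - f_i(x)` is positive
(negative). -/
def interactionGraph (f : Config V → Config V) : SignedDigraph V where
  arcs := {a | ∃ x : Config V, x a.1 = false ∧
    ((a.2.2 = 1 ∧ f x a.2.1 < f (flipAt x a.1) a.2.1) ∨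
      (a.2.2 = -1 ∧ f (flipAt x a.1) a.2.1 < f x a.2.1))}

/-- The asynchronous graph `Γ(f)`. -/
def asyncGraph (f : Config V → Config V) : Digraph (Config V) where
  Adj x y := ∃ i, f x i ≠ x i ∧ y = flipAt x i

/-- `f` is a Boolean network on `G`, that is, `f ∈ F(G)`. -/
def IsNetworkOn (f : Config V → Config V) (G : SignedDigraph V) : Prop :=
  interactionGraph f = G

/-- `G` is converging: `Γ(f)` is converging for every network `f` on `G`. -/
def SignedDigraph.Converging (G : SignedDigraph V) : Prop :=
  ∀ f : Config V → Config V, IsNetworkOn f G → IsConverging (asyncGraph f)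

/-- `G` is trap-separating: `Γ(f)` is trap-separating for every network `f` on `G`. -/
def SignedDigraph.TrapSeparating (G : SignedDigraph V) : Prop :=
  ∀ f : Config V → Config V, IsNetworkOn f G → IsTrapSeparating (asyncGraph f)

end Networks

end BoolNet

/-! Label the vertices by signs and call an arc coherent if its sign is the product of the labels of
its ends. A cycle of coherent arcs is positive. So if every vertex of a nonempty set `S` has a
coherent arc coming from `S`, following these arcs backwards ends in a positive cycle, which must be
`C` (`of_coherent_pred`).

If `f` fixes, at both `x` and `y`, every component where they differ, then labelling by `y` gives
such arcs on the difference set, which therefore contains `C`. Pairs of points from two attractors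
that agree at a vertex of `C` can be moved closer until this applies, so distinct attractors are
opposite on `C` (`ne_of_isAttractor`). Each is then constant on `C`, hence everywhere, since the
graph outside `C` is acyclic (`IsAttractor.subsingleton`). Several attractors are thus all fixed
points, and each is its own trap space.

In the strong case, suppose there are two fixed points. The labelling of `C` by one of them extends
to all vertices, because a path leaving `C` must not return coherently (`exists_labelling`). The
fixed points are then opposite everywhere, which forces each `f c` with `c` in `C` to depend only on
the predecessor of `c` in `C`. By strong connectivity `C` covers `V`, all arcs are coherent, and no
negative cycle exists. -/

namespace BoolNet

open Relation

/-! ### Coherent labellings and the unique positive cycle. -/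

section Cycles

variable {V : Type*} {G : SignedDigraph V}

namespace SignedDigraph

theorem Subgraph.IsCycle.verts_nonempty {D : G.Subgraph} (hD : D.IsCycle) : D.verts.Nonempty := by
  obtain ⟨m, v, s, -, hv, -⟩ := hD
  exact ⟨v 0, (hv _).2 ⟨0, rfl⟩⟩

/-- A cycle whose arc signs are the coboundary of a vertex labelling is positive. -/
theorem Subgraph.IsCycle.sign_eq_one {D : G.Subgraph} (hD : D.IsCycle) (σ : V → ℤˣ)
    (h : ∀ a ∈ D.arcs, a.2.2 = σ a.1 * σ a.2.1) : D.sign = 1 := by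
  classical
  obtain ⟨m, v, s, hinj, -, ha⟩ := hD
  have harcs : D.arcs = Finset.univ.image (fun k => (v k, v (k + 1), s k)) := by
    ext a
    simp [ha]
  have hs : ∀ k, s k = σ (v k) * σ (v (k + 1)) := fun k => h _ ((ha _).2 ⟨k, rfl⟩)
  rw [Subgraph.sign, harcs, Finset.prod_image]
  · simp only [hs, Finset.prod_mul_distrib]
    have h1 : ∏ k, σ (v (k + 1)) = ∏ k, σ (v k) :=
      Equiv.prod_comp (Equiv.addRight (1 : Fin (m + 1))) (fun k => σ (v k))
    rw [h1, Int.units_mul_self]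
  · intro k _ l _ hkl
    exact hinj (congrArg Prod.fst hkl)

/-- If every vertex of `S` is given a predecessor in `S`, then following predecessors leads to a
cycle. -/
theorem exists_cycle_of_pred [Finite V] {S : Set V} (hS : S.Nonempty) (p : V → V) (a : V → ℤˣ)
    (hp : ∀ i ∈ S, p i ∈ S) (ha : ∀ i ∈ S, (p i, i, a i) ∈ G.arcs) :
    ∃ D : G.Subgraph, D.IsCycle ∧ (∀ i ∈ D.verts, i ∈ S) ∧
      (∀ i ∈ D.verts, (p i, i, a i) ∈ D.arcs) ∧
      ∀ b ∈ D.arcs, b = (p b.2.1, b.2.1, a b.2.1) := by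
  classical
  obtain ⟨j, hj⟩ := hS
  have hit : ∀ n, ∀ i ∈ S, p^[n] i ∈ S := fun n => by
    induction n with
    | zero => exact fun i hi => hi
    | succ n ih => exact fun i hi => ih _ (hp i hi)
  obtain ⟨v, hvS, hvp⟩ : ∃ v ∈ S, v ∈ Function.periodicPts p := by
    obtain ⟨m, n, hmn, h⟩ := Finite.exists_ne_map_eq_of_infinite (fun n : ℕ => p^[n] j)
    wlog hlt : m < n generalizing m n
    · exact this n m hmn.symm h.symm (by omega)
    refine ⟨p^[m] j, hit m j hj, n - m, by omega, ?_⟩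
    change p^[n - m] (p^[m] j) = p^[m] j
    rw [← Function.iterate_add_apply, Nat.sub_add_cancel hlt.le]
    exact h.symm
  obtain ⟨m, hm⟩ : ∃ m, Function.minimalPeriod p v = m + 1 :=
    Nat.exists_eq_succ_of_ne_zero (Function.minimalPeriod_pos_of_mem_periodicPts hvp).ne'
  -- The periodic orbit of `p` is enumerated backwards, since `p` goes against the arcs.
  let w : Fin (m + 1) → V := fun k => p^[m - k] v
  have hwS : ∀ k, w k ∈ S := fun k => hit _ _ hvS
  have hinj : Function.Injective w := by
    intro k l hkl
    have := Function.iterate_injOn_Iio_minimalPeriod (f := p) (x := v)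
      (show m - (k : ℕ) < _ by omega) (show m - (l : ℕ) < _ by omega) hkl
    ext
    omega
  have hpw : ∀ k, p (w (k + 1)) = w k := by
    intro k
    rcases eq_or_ne k (Fin.last m) with rfl | hk
    · have h := Function.iterate_minimalPeriod (f := p) (x := v)
      rw [hm, Function.iterate_succ_apply'] at h
      simpa [w] using h
    · have hk' : k < Fin.last m := Fin.lt_last_iff_ne_last.2 hk
      have hk'' : (k : ℕ) < m := hk'
      simp only [w, Fin.val_add_one_of_lt hk']
      rw [← Function.iterate_succ_apply' p]
      congr 2
      omega
  have hsurj : ∀ k : Fin (m + 1), ∃ l, l + 1 = k := fun k => ⟨k - 1, sub_add_cancel k 1⟩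
  refine ⟨⟨Finset.univ.image w, Finset.univ.image fun k => (w k, w (k + 1), a (w (k + 1))),
    ?_, ?_, ?_⟩, ⟨m, w, fun k => a (w (k + 1)), hinj, ?_, ?_⟩, ?_, ?_, ?_⟩
  · simp only [Finset.mem_image, Finset.mem_univ, true_and, forall_exists_index]
    rintro _ k rfl
    simpa [hpw] using ha (w (k + 1)) (hwS _)
  · simp only [Finset.mem_image, Finset.mem_univ, true_and, forall_exists_index]
    rintro _ k rfl
    exact ⟨k, rfl⟩
  · simp only [Finset.mem_image, Finset.mem_univ, true_and, forall_exists_index]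
    rintro _ k rfl
    exact ⟨k + 1, rfl⟩
  · simp
  · simp
  · simp only [Finset.mem_image, Finset.mem_univ, true_and, forall_exists_index]
    rintro _ k rfl
    exact hwS k
  · simp only [Finset.mem_image, Finset.mem_univ, true_and, forall_exists_index]
    rintro _ k rfl
    obtain ⟨l, rfl⟩ := hsurj k
    exact ⟨l, by rw [hpw]⟩
  · simp only [Finset.mem_image, Finset.mem_univ, true_and, forall_exists_index]
    rintro _ k rfl
    simp [hpw]

/-- `C` is the unique positive cycle of `G`, and it meets every negative cycle. -/
structure Subgraph.IsDominantCycle (C : G.Subgraph) : Prop where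
  pos : C.IsPositiveCycle
  unique : ∀ D : G.Subgraph, D.IsPositiveCycle → D = C
  meets : ∀ D : G.Subgraph, D.IsNegativeCycle → D.Intersects C

namespace Subgraph.IsDominantCycle

variable {C : G.Subgraph}

/-- Following predecessors along arcs coherent with a vertex labelling `σ` leads to the unique
positive cycle. -/
theorem of_coherent_pred [Finite V] (hC : C.IsDominantCycle) {S : Set V} (hS : S.Nonempty) {p : V → V}
    {σ : V → ℤˣ} (hp : ∀ i ∈ S, p i ∈ S ∧ (p i, i, σ (p i) * σ i) ∈ G.arcs) :
    (∀ i ∈ C.verts, i ∈ S) ∧ ∀ i ∈ C.verts, (p i, i, σ (p i) * σ i) ∈ C.arcs := by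
  obtain ⟨D, hD, h1, h2, h3⟩ := exists_cycle_of_pred (G := G) hS p (fun i => σ (p i) * σ i)
    (fun i hi => (hp i hi).1) (fun i hi => (hp i hi).2)
  have hsign : D.sign = 1 := by
    refine hD.sign_eq_one σ fun b hb => ?_
    have h := h3 b hb
    have h' : b.1 = p b.2.1 := congrArg Prod.fst h
    rw [h']
    exact congrArg (fun b => b.2.2) h
  obtain rfl := hC.unique D ⟨hD, hsign⟩
  exact ⟨h1, h2⟩

/-- Arcs of `G` between vertices outside `C`. -/
def outside (C : G.Subgraph) (k w : V) : Prop :=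
  k ∉ C.verts ∧ w ∉ C.verts ∧ G.underlying.Adj k w

/-- Otherwise following predecessors outside `C` would give a cycle disjoint from `C`: if positive
it contradicts uniqueness, if negative it contradicts `meets`. This permits induction on the
vertices outside `C`. -/
theorem wellFounded_outside [Finite V] (hC : C.IsDominantCycle) :
    WellFounded (outside C) := by
  rw [WellFounded.wellFounded_iff_has_min]
  intro S hS
  by_contra! h
  choose! p hpS hp using h
  choose! a ha using fun i (hi : i ∈ S) => (hp i hi).2.2
  obtain ⟨D, hD, h1, -⟩ := exists_cycle_of_pred (G := G) hS p a hpS ha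
  have hdisj : ∀ i ∈ D.verts, i ∉ C.verts := fun i hi => (hp i (h1 i hi)).2.1
  rcases Int.units_eq_one_or D.sign with hs | hs
  · obtain rfl := hC.unique D ⟨hD, hs⟩
    obtain ⟨i, hi⟩ := hD.verts_nonempty
    exact hdisj i hi hi
  · obtain ⟨i, hi, hi'⟩ := hC.meets D ⟨hD, hs⟩
    exact hdisj i hi hi'

/-- There is a path of sign `τ * s c` from some vertex `c` of `C` to `w`, whose other vertices are
outside `C`. The path is given by a predecessor map `p` on a set `S`, coherent with a labelling
`σ`, where `S` contains `C` and vertices from which `w` can be reached outside `C`. -/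
def SignedReach (C : G.Subgraph) (s : V → ℤˣ) (w : V) (τ : ℤˣ) : Prop :=
  ∃ (S : Set V) (p : V → V) (σ : V → ℤˣ), w ∈ S ∧ (∀ i ∈ C.verts, i ∈ S ∧ σ i = s i) ∧ σ w = τ ∧
    (∀ i ∈ S, p i ∈ S ∧ (p i, i, σ (p i) * σ i) ∈ G.arcs) ∧
    ∀ v ∈ S, v ∉ C.verts → ReflTransGen (outside C) v w

variable {s : V → ℤˣ} {p : V → V}

theorem signedReach_of_mem
    (hp : ∀ i ∈ C.verts, (p i, i, s (p i) * s i) ∈ C.arcs)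
    {c w : V} {t : ℤˣ} (hc : c ∈ C.verts) (hw : w ∉ C.verts) (h : (c, w, t) ∈ G.arcs) :
    SignedReach C s w (s c * t) := by
  classical
  have hne : ∀ i ∈ C.verts, i ≠ w := fun i hi e => hw (e ▸ hi)
  refine ⟨insert w C.verts, Function.update p w c, Function.update s w (s c * t),
    Set.mem_insert _ _, fun i hi => ⟨Or.inr hi, Function.update_of_ne (hne i hi) _ _⟩,
    Function.update_self _ _ _, ?_, ?_⟩
  · rintro i (rfl | hi)
    · simp only [Function.update_self]
      refine ⟨Or.inr hc, ?_⟩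
      rw [Function.update_of_ne (hne c hc), ← mul_assoc, Int.units_mul_self, one_mul]
      exact h
    · have hpi := C.source_mem _ (hp i hi)
      rw [Function.update_of_ne (hne i hi), Function.update_of_ne (hne i hi),
        Function.update_of_ne (hne _ hpi)]
      exact ⟨Or.inr hpi, C.arcs_mem _ (hp i hi)⟩
  · rintro v (rfl | hv) hv'
    · exact .refl
    · exact absurd hv hv'

theorem SignedReach.step [Finite V] (hC : C.IsDominantCycle) {k w : V} {τ t : ℤˣ}
    (hk : SignedReach C s k τ) (hkC : k ∉ C.verts) (hw : w ∉ C.verts)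
    (h : (k, w, t) ∈ G.arcs) : SignedReach C s w (τ * t) := by
  classical
  obtain ⟨S, q, σ, hkS, hCS, rfl, hq, hS⟩ := hk
  have hkw : outside C k w := ⟨hkC, hw, t, h⟩
  -- The last clause of `SignedReach` serves here: if `w` were already in `S`, it would lie on a
  -- closed walk outside `C`.
  have hwS : w ∉ S := fun hwS =>
    have hloop : TransGen (outside C) w w := TransGen.tail' (hS w hwS hw) hkw
    hC.wellFounded_outside.transGen.irrefl.irrefl w hloop
  have hne : ∀ i ∈ S, i ≠ w := fun i hi e => hwS (e ▸ hi)
  refine ⟨insert w S, Function.update q w k, Function.update σ w (σ k * t), Set.mem_insert _ _,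
    fun i hi => ⟨Or.inr (hCS i hi).1, ?_⟩, Function.update_self _ _ _, ?_, ?_⟩
  · rw [Function.update_of_ne (hne i (hCS i hi).1), (hCS i hi).2]
  · rintro i (rfl | hi)
    · simp only [Function.update_self]
      refine ⟨Or.inr hkS, ?_⟩
      rw [Function.update_of_ne (hne k hkS), ← mul_assoc, Int.units_mul_self, one_mul]
      exact h
    · obtain ⟨hqi, hqa⟩ := hq i hi
      rw [Function.update_of_ne (hne i hi), Function.update_of_ne (hne i hi),
        Function.update_of_ne (hne _ hqi)]
      exact ⟨Or.inr hqi, hqa⟩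
  · rintro v (rfl | hv) hv'
    · exact .refl
    · exact (hS v hv hv').tail hkw

/-- A path leaving `C` and returning to it is incoherent, as otherwise it would give a second
positive cycle. -/
theorem SignedReach.ne_of_mem [Finite V] (hC : C.IsDominantCycle) {k c : V} {τ t : ℤˣ}
    (hk : SignedReach C s k τ) (hkC : k ∉ C.verts) (hc : c ∈ C.verts)
    (h : (k, c, t) ∈ G.arcs) : t ≠ τ * s c := by
  classical
  rintro rfl
  obtain ⟨S, q, σ, hkS, hCS, rfl, hq, -⟩ := hk
  -- Redirecting the predecessor of `c` to `k` keeps the map coherent, so the arc from `k` to `c`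
  -- would belong to `C`.
  have hq' : ∀ i ∈ S, Function.update q c k i ∈ S ∧
      (Function.update q c k i, i, σ (Function.update q c k i) * σ i) ∈ G.arcs := by
    intro i hi
    rcases eq_or_ne i c with rfl | hic
    · simp only [Function.update_self]
      rw [(hCS i hc).2]
      exact ⟨hkS, h⟩
    · rw [Function.update_of_ne hic]
      exact hq i hi
  have := C.source_mem _ ((hC.of_coherent_pred ⟨k, hkS⟩ hq').2 c hc)
  simp only [Function.update_self] at this
  exact hkC this

/-- Where an arc returns to `C`, incoherence excludes one of the two signs, so `τ` is determined.
Determinacy propagates backwards along a path from `w` to `C`. -/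
theorem SignedReach.unique [Finite V] (hC : C.IsDominantCycle) (hG : G.IsStrong) {w : V} {τ τ' : ℤˣ}
    (hw : w ∉ C.verts) (h : SignedReach C s w τ) (h' : SignedReach C s w τ') : τ = τ' := by
  obtain ⟨c, hc⟩ := hC.pos.1.verts_nonempty
  induction hG w c using ReflTransGen.head_induction_on generalizing τ τ' with
  | refl => exact absurd hc hw
  | @head k l hkl _ ih =>
    obtain ⟨t, ht⟩ := hkl
    by_cases hl : l ∈ C.verts
    · have h1 := h.ne_of_mem hC hw hl ht
      have h2 := h'.ne_of_mem hC hw hl ht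
      rw [Int.units_ne_iff_eq_neg] at h1 h2
      exact mul_right_cancel (neg_injective (h1.symm.trans h2))
    · exact mul_right_cancel (ih hl (h.step hC hw hl ht) (h'.step hC hw hl ht))

theorem exists_signedReach [Finite V] (hC : C.IsDominantCycle) (hG : G.IsStrong)
    (hp : ∀ i ∈ C.verts, (p i, i, s (p i) * s i) ∈ C.arcs)
    {w : V} (hw : w ∉ C.verts) : ∃ τ, SignedReach C s w τ := by
  obtain ⟨c, hc⟩ := hC.pos.1.verts_nonempty
  induction hG c w with
  | refl => exact absurd hc hw
  | @tail k l _ hkl ih =>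
    obtain ⟨t, ht⟩ := hkl
    by_cases hk : k ∈ C.verts
    · exact ⟨_, signedReach_of_mem hp hk hw ht⟩
    · obtain ⟨τ, hτ⟩ := ih hk
      exact ⟨_, hτ.step hC hk hw ht⟩

/-- If `G` is strong, then the labelling of `C` extends to a labelling of `G` for which all the arcs
entering a vertex outside `C` are coherent, and the only coherent arcs entering `C` are the arcs of
`C`. -/
theorem exists_labelling [Finite V] (hC : C.IsDominantCycle) (hG : G.IsStrong)
    (hp : ∀ i ∈ C.verts, (p i, i, s (p i) * s i) ∈ C.arcs) :
    ∃ σ : V → ℤˣ, (∀ i ∈ C.verts, σ i = s i) ∧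
      (∀ k w t, (k, w, t) ∈ G.arcs → w ∉ C.verts → t = σ k * σ w) ∧
      ∀ k c, (k, c, σ k * σ c) ∈ G.arcs → c ∈ C.verts → k = p c := by
  classical
  choose! ρ hρ using fun (w : V) (hw : w ∉ C.verts) => hC.exists_signedReach hG hp hw
  refine ⟨fun w => if w ∈ C.verts then s w else ρ w, fun i hi => if_pos hi, ?_, ?_⟩
  · intro k w t h hw
    simp only [if_neg hw]
    split_ifs with hk
    · rw [(hρ w hw).unique hC hG hw (signedReach_of_mem hp hk hw h), ← mul_assoc,
        Int.units_mul_self, one_mul]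
    · rw [(hρ w hw).unique hC hG hw ((hρ k hk).step hC hk hw h), ← mul_assoc,
        Int.units_mul_self, one_mul]
  · intro k c h hc
    simp only [if_pos hc] at h
    split_ifs at h with hk
    · have hq : ∀ i ∈ (C.verts : Set V), Function.update p c k i ∈ (C.verts : Set V) ∧
          (Function.update p c k i, i, s (Function.update p c k i) * s i) ∈ G.arcs := by
        intro i hi
        rcases eq_or_ne i c with rfl | hic
        · simp only [Function.update_self]
          exact ⟨hk, h⟩
        · rw [Function.update_of_ne hic]
          exact ⟨C.source_mem _ (hp i hi), C.arcs_mem _ (hp i hi)⟩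
      have hkc := (hC.of_coherent_pred ⟨c, hc⟩ hq).2 c hc
      simp only [Function.update_self] at hkc
      -- both predecessor maps describe the arcs of the cycle `C`
      obtain ⟨m, v, a, hinj, -, ha⟩ := hC.pos.1
      obtain ⟨i, hi⟩ := (ha _).1 hkc
      obtain ⟨j, hj⟩ := (ha _).1 (hp c hc)
      simp only [Prod.mk.injEq] at hi hj
      have hij : i = j := add_right_cancel (hinj (hi.2.1.trans hj.2.1.symm))
      rw [← hi.1, ← hj.1, hij]
    · exact absurd rfl ((hρ k hk).ne_of_mem hC hk hc h)

end Subgraph.IsDominantCycle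

end SignedDigraph

end Cycles

/-! ### Trap sets and attractors of a digraph on configurations. -/

section Dynamics

variable {V : Type*}

theorem IsTrapSet.inter {Γ : Digraph (Config V)} {X Y : Set (Config V)} (hX : IsTrapSet Γ X)
    (hY : IsTrapSet Γ Y) : IsTrapSet Γ (X ∩ Y) :=
  fun x hx y hxy => ⟨hX x hx.1 y hxy, hY x hx.2 y hxy⟩

theorem IsAttractor.disjoint {Γ : Digraph (Config V)} {A B : Set (Config V)}
    (hA : IsAttractor Γ A) (hB : IsAttractor Γ B) (hAB : A ≠ B) : Disjoint A B := by
  rw [Set.disjoint_iff_inter_eq_empty]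
  by_contra h
  have hAB' : (A ∩ B).Nonempty ∧ IsTrapSet Γ (A ∩ B) :=
    ⟨Set.nonempty_iff_ne_empty.2 h, hA.prop.2.inter hB.prop.2⟩
  exact hAB ((hA.eq_of_subset hAB' Set.inter_subset_left).symm.trans
    (hB.eq_of_subset hAB' Set.inter_subset_right))

theorem exists_isAttractor [Finite V] (Γ : Digraph (Config V)) : ∃ A, IsAttractor Γ A := by
  obtain ⟨A, -, hA⟩ := exists_minimal_le_of_wellFoundedLT
    (fun X : Set (Config V) => X.Nonempty ∧ IsTrapSet Γ X) Set.univ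
    ⟨Set.univ_nonempty, fun _ _ _ _ => trivial⟩
  exact ⟨A, hA⟩

theorem trapHull_singleton {Γ : Digraph (Config V)} {x : Config V} (h : IsTrapSet Γ {x}) :
    trapHull Γ {x} = {x} :=
  have hl := trapHull_isLeast Γ (Set.singleton_nonempty x)
  (hl.2 ⟨⟨⟨x, x, le_rfl, by simp⟩, h⟩, subset_rfl⟩).antisymm hl.1.2

end Dynamics

/-! ### Boolean networks whose interaction graph has a dominant cycle. -/

section Networks

variable {V : Type*} [DecidableEq V] {f : Config V → Config V}

theorem flipAt_self (x : Config V) (i : V) : flipAt x i i = !x i := Function.update_self _ _ _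

theorem flipAt_of_ne (x : Config V) {i k : V} (h : k ≠ i) : flipAt x i k = x k :=
  Function.update_of_ne h _ _

theorem flipAt_flipAt (x : Config V) (i : V) : flipAt (flipAt x i) i = x := by
  simp [flipAt]

theorem hammingDist_flipAt_lt [Fintype V] {x y : Config V} {i : V} (h : x i ≠ y i) :
    hammingDist (flipAt x i) y < hammingDist x y := by
  refine Finset.card_lt_card ((Finset.ssubset_iff_of_subset ?_).2 ⟨i, ?_, ?_⟩)
  · intro k
    rcases eq_or_ne k i with rfl | hk
    · simp [h]
    · simp [flipAt_of_ne x hk]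
  · simpa using h
  · simpa [flipAt_self] using h

/-- The sign of a Boolean value. -/
def boolSign (b : Bool) : ℤˣ := if b then 1 else -1

theorem boolSign_injective : Function.Injective boolSign := by decide

theorem boolSign_not (b : Bool) : boolSign (!b) = -boolSign b := by cases b <;> simp [boolSign]

theorem exists_boolSign_eq (τ : ℤˣ) : ∃ b, boolSign b = τ := by
  rcases Int.units_eq_one_or τ with rfl | rfl
  · exact ⟨true, rfl⟩
  · exact ⟨false, rfl⟩

/-- Writing the sign as a product of the new values makes arcs found by comparing configurations
coherent by construction. -/
theorem arc_of_flipAt_ne {x : Config V} {k j : V} (h : f x j ≠ f (flipAt x k) j) :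
    (k, j, boolSign (!x k) * boolSign (f (flipAt x k) j)) ∈ (interactionGraph f).arcs := by
  cases hx : x k
  · refine ⟨x, hx, ?_⟩
    cases h1 : f x j <;> cases h2 : f (flipAt x k) j <;> simp_all [boolSign]
  · refine ⟨flipAt x k, by simp [flipAt_self, hx], ?_⟩
    simp only [flipAt_flipAt]
    cases h1 : f x j <;> cases h2 : f (flipAt x k) j <;> simp_all [boolSign]

theorem exists_flipAt_ne_of_arc {k j : V} {t : ℤˣ} (h : (k, j, t) ∈ (interactionGraph f).arcs) :
    ∃ x, x k = false ∧ f x j ≠ f (flipAt x k) j ∧ t = boolSign (f (flipAt x k) j) := by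
  obtain ⟨x, hx, ⟨ht, hlt⟩ | ⟨ht, hlt⟩⟩ := h
  · refine ⟨x, hx, hlt.ne, ?_⟩
    simp only [Bool.lt_iff] at hlt
    rw [hlt.2]
    exact ht
  · refine ⟨x, hx, hlt.ne', ?_⟩
    simp only [Bool.lt_iff] at hlt
    rw [hlt.1]
    exact ht

/-- If `f_j` takes different values at `x` and `y`, then the variation is due to some arc into `j`
from a component at which `x` and `y` differ. -/
theorem exists_arc_of_ne [Finite V] {x y : Config V} {j : V} (h : f x j ≠ f y j) :
    ∃ k, x k ≠ y k ∧ (k, j, boolSign (y k) * boolSign (f y j)) ∈ (interactionGraph f).arcs := by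
  have := Fintype.ofFinite V
  induction hn : hammingDist x y using Nat.strong_induction_on generalizing x with
  | _ n ih =>
    obtain ⟨k, hk⟩ : ∃ k, x k ≠ y k := by
      by_contra! hxy
      exact h (by rw [funext hxy])
    by_cases hf : f x j = f (flipAt x k) j
    · obtain ⟨l, hl, ha⟩ := ih _ (hn ▸ hammingDist_flipAt_lt hk) (hf ▸ h) rfl
      refine ⟨l, ?_, ha⟩
      rcases eq_or_ne l k with rfl | hlk
      · exact hk
      · rwa [flipAt_of_ne x hlk] at hl
    · refine ⟨k, hk, ?_⟩
      have h1 : (!x k) = y k := by simpa [Bool.eq_not, eq_comm] using hk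
      have h2 : f (flipAt x k) j = f y j := by
        revert h hf
        generalize f x j = a
        generalize f y j = b
        generalize f (flipAt x k) j = c
        revert a b c
        decide
      rw [← h1, ← h2]
      exact arc_of_flipAt_ne hf

/-- If `f_j(x) = x_j ≠ y_j = f_j(y)` for all the components `j` at which `x` and `y` differ, then
these components contain the unique positive cycle. -/
theorem exists_pred_of_locally_fixed [Finite V] {C : (interactionGraph f).Subgraph}
    (hC : C.IsDominantCycle) {x y : Config V} (hxy : x ≠ y)
    (h : ∀ j, x j ≠ y j → f x j = x j ∧ f y j = y j) :
    (∀ i ∈ C.verts, x i ≠ y i) ∧ ∃ p : V → V, ∀ i ∈ C.verts,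
      (p i, i, boolSign (y (p i)) * boolSign (y i)) ∈ C.arcs := by
  have hpred : ∀ i ∈ {i | x i ≠ y i}, ∃ k, k ∈ {i | x i ≠ y i} ∧
      (k, i, boolSign (y k) * boolSign (y i)) ∈ (interactionGraph f).arcs := by
    intro i hi
    obtain ⟨h1, h2⟩ := h i hi
    obtain ⟨k, hk, ha⟩ := exists_arc_of_ne (f := f) (x := x) (y := y) (j := i)
      (by rw [h1, h2]; exact hi)
    exact ⟨k, hk, h2 ▸ ha⟩
  choose! p hp using hpred
  obtain ⟨i, hi⟩ := Function.ne_iff.1 hxy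
  obtain ⟨h1, h2⟩ := hC.of_coherent_pred (S := {i | x i ≠ y i}) ⟨i, hi⟩
    (σ := fun i => boolSign (y i)) hp
  exact ⟨h1, p, h2⟩

theorem IsTrapSet.flipAt_mem {X : Set (Config V)} (hX : IsTrapSet (asyncGraph f) X)
    {x : Config V} (hx : x ∈ X) {i : V} (hi : f x i ≠ x i) : flipAt x i ∈ X :=
  hX x hx _ ⟨i, hi, rfl⟩

/-- Two distinct attractors take opposite constant values on the unique positive cycle. -/
theorem ne_of_isAttractor [Finite V] {C : (interactionGraph f).Subgraph}
    (hC : C.IsDominantCycle) {A B : Set (Config V)} (hA : IsAttractor (asyncGraph f) A)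
    (hB : IsAttractor (asyncGraph f) B) (hAB : A ≠ B) {i : V} (hi : i ∈ C.verts)
    {x y : Config V} (hx : x ∈ A) (hy : y ∈ B) : x i ≠ y i := by
  have := Fintype.ofFinite V
  intro hxy
  induction hn : hammingDist x y using Nat.strong_induction_on generalizing x y with
  | _ n ih =>
    subst hn
    -- If `f` moves a differing component `j` of `x` or `y`, flipping it stays in the attractor,
    -- reduces the distance and preserves the agreement at `i`. Otherwise the difference set
    -- contains `C`, hence `i`.
    refine (exists_pred_of_locally_fixed hC
      ((hA.disjoint hB hAB).ne_of_mem hx hy) fun j hj => ⟨?_, ?_⟩).1 i hi hxy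
    · by_contra hf
      refine ih _ (hammingDist_flipAt_lt hj) (hA.prop.2.flipAt_mem hx hf) hy ?_ rfl
      rwa [flipAt_of_ne x (fun e : i = j => hj (e ▸ hxy))]
    · by_contra hf
      refine ih _ ?_ hx (hB.prop.2.flipAt_mem hy hf) ?_ rfl
      · rw [hammingDist_comm, hammingDist_comm x y]
        exact hammingDist_flipAt_lt hj.symm
      · rwa [flipAt_of_ne y (fun e : i = j => hj (e ▸ hxy))]

/-- An attractor on which the components of `C` are constant is a singleton, since the components
outside `C` are then constant too, by induction along the acyclic graph outside `C`. -/
theorem IsAttractor.subsingleton [Finite V] {C : (interactionGraph f).Subgraph}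
    (hC : C.IsDominantCycle) {A : Set (Config V)} (hA : IsAttractor (asyncGraph f) A)
    (hconst : ∀ i ∈ C.verts, ∀ x ∈ A, ∀ y ∈ A, x i = y i) : A.Subsingleton := by
  suffices H : ∀ w, ∀ x ∈ A, ∀ y ∈ A, x w = y w from
    fun x hx y hy => funext fun w => H w x hx y hy
  intro w
  induction w using hC.wellFounded_outside.induction with
  | _ w ih =>
    by_cases hw : w ∈ C.verts
    · exact hconst w hw
    have hf : ∀ x ∈ A, ∀ y ∈ A, f x w = f y w := by
      intro x hx y hy
      by_contra hne
      obtain ⟨k, hk, ha⟩ := exists_arc_of_ne hne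
      by_cases hkC : k ∈ C.verts
      · exact hk (hconst k hkC x hx y hy)
      · exact hk (ih k ⟨hkC, hw, _, ha⟩ x hx y hy)
    by_contra! h
    obtain ⟨x, hx, y, hy, hxy⟩ := h
    obtain ⟨z, hz, hzw⟩ : ∃ z ∈ A, z w = f x w := by
      by_cases h : x w = f x w
      · exact ⟨x, hx, h⟩
      · refine ⟨y, hy, ?_⟩
        revert hxy h
        generalize x w = a
        generalize y w = b
        generalize f x w = c
        revert a b c
        decide
    -- As `f` is constant at `w` on `A`, a component `w` that has reached this value never flips
    -- again; minimality then gives the whole of `A`.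
    have htrap : IsTrapSet (asyncGraph f) (A ∩ {u | u w = f x w}) := by
      rintro u ⟨huA, huw⟩ _ ⟨i, hi, rfl⟩
      refine ⟨hA.prop.2.flipAt_mem huA hi, ?_⟩
      have hne : w ≠ i := by
        rintro rfl
        exact hi ((hf u huA x hx).trans huw.symm)
      exact (flipAt_of_ne u hne).trans huw
    have hAeq : A ∩ {u | u w = f x w} = A :=
      hA.eq_of_subset (show Set.Nonempty _ ∧ _ from ⟨⟨z, hz, hzw⟩, htrap⟩) Set.inter_subset_left
    rw [← hAeq] at hx hy
    exact hxy (hx.2.trans hy.2.symm)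

/-- On `C`, every point of `A` is opposite to one chosen point of `B`, so `A` is constant there. -/
theorem exists_eq_singleton_of_ne [Finite V] {C : (interactionGraph f).Subgraph}
    (hC : C.IsDominantCycle) {A B : Set (Config V)} (hA : IsAttractor (asyncGraph f) A)
    (hB : IsAttractor (asyncGraph f) B) (hAB : A ≠ B) : ∃ x, A = {x} ∧ f x = x := by
  have hs : A.Subsingleton := hA.subsingleton hC fun i hi x hx y hy => by
    obtain ⟨z, hz⟩ := hB.prop.1
    have h1 := ne_of_isAttractor hC hA hB hAB hi hx hz
    have h2 := ne_of_isAttractor hC hA hB hAB hi hy hz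
    exact (Bool.eq_not_iff.2 h1).trans (Bool.eq_not_iff.2 h2).symm
  obtain ⟨x, hx⟩ := hA.prop.1
  refine ⟨x, hs.eq_singleton_of_mem hx, funext fun i => ?_⟩
  by_contra hi
  have := congrFun (hs hx (hA.prop.2.flipAt_mem hx hi)) i
  simp [flipAt_self] at this

theorem isFixing_or_isConverging [Finite V] {C : (interactionGraph f).Subgraph}
    (hC : C.IsDominantCycle) : IsFixing (asyncGraph f) ∨ IsConverging (asyncGraph f) := by
  by_cases h : ∃ A B, IsAttractor (asyncGraph f) A ∧ IsAttractor (asyncGraph f) B ∧ A ≠ B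
  · left
    obtain ⟨A, B, hA, hB, hAB⟩ := h
    intro D hD
    obtain ⟨x, rfl, -⟩ : ∃ x, D = {x} ∧ f x = x := by
      by_cases hDA : D = A
      · exact exists_eq_singleton_of_ne hC hD hB (hDA ▸ hAB)
      · exact exists_eq_singleton_of_ne hC hD hA hDA
    exact Set.ncard_singleton x
  · right
    push Not at h
    obtain ⟨A, hA⟩ := exists_isAttractor (asyncGraph f)
    exact ⟨A, hA, fun B hB => h B A hB hA⟩

theorem isTrapSeparating [Finite V] {C : (interactionGraph f).Subgraph}
    (hC : C.IsDominantCycle) : IsTrapSeparating (asyncGraph f) := by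
  intro A B hA hB hAB
  obtain ⟨x, rfl, -⟩ := exists_eq_singleton_of_ne hC hA hB hAB
  obtain ⟨y, rfl, -⟩ := exists_eq_singleton_of_ne hC hB hA hAB.symm
  rw [trapHull_singleton hA.prop.2, trapHull_singleton hB.prop.2]
  exact Set.disjoint_iff_inter_eq_empty.1 (hA.disjoint hB hAB)

/-- If the interaction graph is strong and `f` has two fixed points, then all the cycles are
positive. -/
theorem sign_eq_one_of_fixed_points [Finite V] {C : (interactionGraph f).Subgraph}
    (hC : C.IsDominantCycle) (hG : (interactionGraph f).IsStrong) {x y : Config V}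
    (hx : f x = x) (hy : f y = y) (hxy : x ≠ y) {D : (interactionGraph f).Subgraph}
    (hD : D.IsCycle) : D.sign = 1 := by
  obtain ⟨hCxy, p, hp⟩ := exists_pred_of_locally_fixed hC hxy
    fun j _ => ⟨congrFun hx j, congrFun hy j⟩
  obtain ⟨σ, hσ, hout, hin⟩ := hC.exists_labelling hG (s := fun i => boolSign (y i)) hp
  -- `x` and `y` are opposite, and `y` is given by the labelling
  have key : ∀ w, x w ≠ y w ∧ boolSign (y w) = σ w := by
    intro w
    induction w using hC.wellFounded_outside.induction with
    | _ w ih =>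
      by_cases hw : w ∈ C.verts
      · exact ⟨hCxy w hw, (hσ w hw).symm⟩
      have ih' : ∀ k t, (k, w, t) ∈ (interactionGraph f).arcs →
          x k ≠ y k ∧ boolSign (y k) = σ k := by
        intro k t h
        by_cases hk : k ∈ C.verts
        · exact ⟨hCxy k hk, (hσ k hk).symm⟩
        · exact ih k ⟨hk, hw, t, h⟩
      -- By strong connectivity `w` has an incoming arc, so `f` is not constant at `w`.
      obtain ⟨u, v, huv⟩ : ∃ u v, f u w ≠ f v w := by
        obtain ⟨c, hc⟩ := hC.pos.1.verts_nonempty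
        rcases (hG c w).cases_tail with h | ⟨k, -, t, ht⟩
        · exact absurd (h ▸ hc) hw
        · obtain ⟨z, -, hz, -⟩ := exists_flipAt_ne_of_arc ht
          exact ⟨_, _, hz⟩
      have hval : ∀ b, ∃ z, f z w = b := by
        intro b
        by_cases hu : f u w = b
        · exact ⟨u, hu⟩
        · refine ⟨v, ?_⟩
          revert hu huv
          generalize f u w = a
          generalize f v w = c
          revert a b c
          decide
      obtain ⟨b, hb⟩ := exists_boolSign_eq (σ w)
      -- All arcs into `w` are coherent with `σ` and `y` matches `σ` on their sources, so `y` is the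
      -- most favourable input for the value `b`; `x` is the least favourable.
      have hyw : f y w = b := by
        obtain ⟨z, hz⟩ := hval b
        by_contra hne
        obtain ⟨k, hk, ha⟩ := exists_arc_of_ne (f := f) (x := y) (y := z) (j := w)
          (by rw [hz]; exact hne)
        have h := hout k w _ ha hw
        rw [hz, hb, ← (ih' k _ ha).2] at h
        exact hk (boolSign_injective (mul_right_cancel h)).symm
      have hxw : f x w = !b := by
        obtain ⟨z, hz⟩ := hval (!b)
        by_contra hne
        obtain ⟨k, hk, ha⟩ := exists_arc_of_ne (f := f) (x := x) (y := z) (j := w)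
          (by rw [hz]; exact hne)
        have h := hout k w _ ha hw
        rw [hz, boolSign_not, hb, mul_neg, ← neg_mul, ← (ih' k _ ha).2, ← boolSign_not] at h
        have h1 := boolSign_injective (mul_right_cancel h)
        have h2 := (ih' k _ ha).1
        rw [← h1] at h2
        exact hk (by rw [Bool.eq_not_iff.2 h2, Bool.not_not])
      rw [← congrFun hx w, ← congrFun hy w, hyw, hxw]
      exact ⟨by simp, hb⟩
  have hopp : ∀ {z : Config V} {k}, x k ≠ z k → z k = y k := fun {z k} h =>
    (Bool.eq_not_iff.2 h.symm).trans (Bool.eq_not_iff.2 (key k).1.symm).symm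
  -- on the cycle, `f` only depends on the predecessor
  have hCx : ∀ c ∈ C.verts, ∀ z : Config V, z (p c) = x (p c) → f z c = x c := by
    intro c hc z hz
    by_contra hne
    obtain ⟨k, hk, ha⟩ := exists_arc_of_ne (f := f) (x := x) (y := z) (j := c)
      (by rw [hx]; exact fun e => hne e.symm)
    -- The arc found is coherent with `σ`, so `hin` identifies its source as `p c`, where `x` and
    -- `z` agree.
    rw [hopp hk, hopp (z := f z) (fun e => hne e.symm), (key k).2, (key c).2] at ha
    exact hk (by rw [hin k c ha hc, hz])
  have hCy : ∀ c ∈ C.verts, ∀ z : Config V, z (p c) = y (p c) → f z c = y c := by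
    intro c hc z hz
    by_contra hne
    obtain ⟨k, hk, ha⟩ := exists_arc_of_ne (f := f) (x := y) (y := z) (j := c)
      (by rw [hy]; exact fun e => hne e.symm)
    rw [Bool.eq_not_iff.2 hk.symm, Bool.eq_not_iff.2 hne, boolSign_not, boolSign_not, neg_mul_neg,
      (key k).2, (key c).2] at ha
    exact hk (by rw [hin k c ha hc, hz])
  -- Flipping a component other than `p c` cannot change `f` at `c`; for `p c` itself, the sign is
  -- read off from the value of `f` at `c` when that component is `true`.
  have hCarc : ∀ c ∈ C.verts, ∀ k t, (k, c, t) ∈ (interactionGraph f).arcs →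
      k ∈ C.verts ∧ t = σ k * σ c := by
    intro c hc k t h
    obtain ⟨z, hz0, hz, rfl⟩ := exists_flipAt_ne_of_arc h
    have hk : k = p c := by
      by_contra hk
      have hflip := flipAt_of_ne z (Ne.symm hk)
      by_cases h : z (p c) = y (p c)
      · exact hz ((hCy c hc z h).trans (hCy c hc _ (hflip.trans h)).symm)
      · have h' : z (p c) = x (p c) :=
          by_contra fun e => h (hopp (Ne.symm e))
        exact hz ((hCx c hc z h').trans (hCx c hc _ (hflip.trans h')).symm)
    refine ⟨hk ▸ C.source_mem _ (hp c hc), ?_⟩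
    have hflip : flipAt z k k = true := by rw [flipAt_self, hz0]; rfl
    rw [← (key k).2, ← (key c).2]
    cases hyk : y k
    · have hxk : x k = true := by
        have := (key k).1
        rw [hyk] at this
        simpa using this
      rw [hCx c hc (flipAt z k) (by rw [← hk, hflip, hxk]), Bool.eq_not_iff.2 (key c).1,
        boolSign_not]
      cases y c <;> simp [boolSign]
    · rw [hCy c hc (flipAt z k) (by rw [← hk, hflip, hyk])]
      simp [boolSign]
  -- `C.verts` is closed under predecessors, and every vertex has a path to it.
  have hall : ∀ v, v ∈ C.verts := by
    intro v
    obtain ⟨c, hc⟩ := hC.pos.1.verts_nonempty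
    induction hG v c using ReflTransGen.head_induction_on with
    | refl => exact hc
    | head h _ ih =>
      obtain ⟨t, ht⟩ := h
      exact (hCarc _ ih _ _ ht).1
  exact hD.sign_eq_one σ fun a ha => (hCarc a.2.1 (hall _) a.1 a.2.2 (D.arcs_mem a ha)).2

theorem isConverging_of_isStrong [Finite V] {C D : (interactionGraph f).Subgraph}
    (hC : C.IsDominantCycle) (hG : (interactionGraph f).IsStrong) (hD : D.IsNegativeCycle) :
    IsConverging (asyncGraph f) := by
  obtain ⟨A, hA⟩ := exists_isAttractor (asyncGraph f)
  refine ⟨A, hA, fun B hB => ?_⟩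
  by_contra hBA
  obtain ⟨x, rfl, hx⟩ := exists_eq_singleton_of_ne hC hA hB (Ne.symm hBA)
  obtain ⟨y, rfl, hy⟩ := exists_eq_singleton_of_ne hC hB hA hBA
  have h := sign_eq_one_of_fixed_points hC hG hx hy (fun e => hBA (by rw [e])) hD.1
  rw [hD.2] at h
  exact absurd h (by decide)

end Networks

end BoolNet

theorem proposition4p3 {V : Type*} [Finite V] [DecidableEq V] (G : BoolNet.SignedDigraph V)
    (C : G.Subgraph) (hC : C.IsPositiveCycle)
    (hC_unique : ∀ D : G.Subgraph, D.IsPositiveCycle → D = C)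
    (h_neg : ∀ D : G.Subgraph, D.IsNegativeCycle → D.Intersects C) :
    G.TrapSeparating ∧
    (∀ f : BoolNet.Config V → BoolNet.Config V, BoolNet.IsNetworkOn f G →
      BoolNet.IsFixing (BoolNet.asyncGraph f) ∨ BoolNet.IsConverging (BoolNet.asyncGraph f)) ∧
    (G.IsStrong → (∃ D : G.Subgraph, D.IsNegativeCycle) → G.Converging) := by
  refine ⟨?_, ?_, ?_⟩
  · rintro f rfl
    exact BoolNet.isTrapSeparating ⟨hC, hC_unique, h_neg⟩
  · rintro f rfl
    exact BoolNet.isFixing_or_isConverging ⟨hC, hC_unique, h_neg⟩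
  · rintro hG ⟨D, hD⟩ f rfl
    exact BoolNet.isConverging_of_isStrong ⟨hC, hC_unique, h_neg⟩ hG hD
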